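/- Let $G=\mathrm{PSL}_2(\mathbb R)$. A *$G$-space* is a topological space $X$ with a $G$-action such that the action map $G\times X\to X$ is continuous. Let $\mu$ be a $G$-invariant Borel probability measure on a $G$-space $X$. We say that $(X,\mu)$ has the *qualitative Sobolev embedding property* if there exist $1\le p<q\le\infty$ and a nonnegative continuous function $\varphi\in L^1(G)$ (with respect to Haar measure), not identically zero, such that for all $f\in L^p(X,\mu)$ the convolution $$(\varphi * f)(x)=\int_G \varphi(g)\,f(g^{-1}x)\,dg$$ (which converges absolutely for $\mu$-almost every $x$) lies in $L^q(X,\mu)$. **Theorem.** Let $X$ be a connected Hausdorff $G$-space equipped with a $G$-invariant Borel probability measure $\mu$ of full support (every nonempty open subset of $X$ has positive measure). Assume that $(X,\mu)$ has the qualitative Sobolev embedding property. Then either $X$ is a point, or there is a cocompact lattice $\Gamma$ in $G$ (a discrete subgroup such that $\Gamma\backslash G$ is compact and carries a $G$-invariant Borel probability measure) such that $X\simeq\Gamma\backslash G$ as $G$-spaces, i.e. there is a $G$-equivariant homeomorphism $X\to\Gamma\backslash G$, where $g\in G$ acts on $\Gamma\backslash G$ by $g\cdot\Gamma a=\Gamma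 a g^{-1}$. -/

import Mathlib

open MeasureTheory
open scoped ENNReal

/-- The topological group `G = PSL₂(ℝ) = SL₂(ℝ) / {±1}`, with the quotient topology of the
subspace topology of `SL₂(ℝ) ⊆ M₂(ℝ)`. -/
abbrev PSL2R : Type := Matrix.ProjectiveSpecialLinearGroup (Fin 2) ℝ

/-- The set `Γ \ G` of right cosets `Γ a`, `a ∈ G`. -/
def CosetSpace {G : Type*} [Group G] (Γ : Subgroup G) : Type _ :=
  Quotient (QuotientGroup.rightRel Γ)

namespace CosetSpace

variable {G : Type*} [Group G] (Γ : Subgroup G)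

/-- The coset `Γ a`. -/
def mk (a : G) : CosetSpace Γ := Quotient.mk (QuotientGroup.rightRel Γ) a

theorem mk_surjective : Function.Surjective (mk Γ) := Quotient.mk_surjective

theorem mk_eq_iff (a b : G) : mk Γ a = mk Γ b ↔ b * a⁻¹ ∈ Γ := by
  exact (Quotient.eq (r := QuotientGroup.rightRel Γ)).trans QuotientGroup.rightRel_apply

/-- The left action of `G` on `Γ \ G` by right translation: `g • Γ a = Γ a g⁻¹`. -/
instance : MulAction G (CosetSpace Γ) where
  smul g := Quotient.map' (fun a => a * g⁻¹) (by
    intro a b h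
    rw [QuotientGroup.rightRel_apply] at h ⊢
    simpa [mul_assoc] using h)
  one_smul x := by
    obtain ⟨a, rfl⟩ := mk_surjective Γ x
    change mk Γ (a * 1⁻¹) = mk Γ a
    simp
  mul_smul g h x := by
    obtain ⟨a, rfl⟩ := mk_surjective Γ x
    change mk Γ (a * (g * h)⁻¹) = mk Γ (a * h⁻¹ * g⁻¹)
    simp [mul_assoc]

theorem smul_mk (g a : G) : g • mk Γ a = mk Γ (a * g⁻¹) := rfl

/-- The quotient topology on `Γ \ G`. -/
instance [TopologicalSpace G] : TopologicalSpace (CosetSpace Γ) :=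
  inferInstanceAs (TopologicalSpace (Quotient (QuotientGroup.rightRel Γ)))

/-- The Borel σ-algebra on `Γ \ G`. -/
instance [TopologicalSpace G] : MeasurableSpace (CosetSpace Γ) := borel _

instance [TopologicalSpace G] : BorelSpace (CosetSpace Γ) := ⟨rfl⟩

end CosetSpace

/-- `Γ` is a lattice in `G`: a discrete subgroup such that `Γ \ G` carries a `G`-invariant
Borel probability measure. -/
def IsLattice {G : Type*} [Group G] [TopologicalSpace G] (Γ : Subgroup G) : Prop :=
  DiscreteTopology Γ ∧
    ∃ m : Measure (CosetSpace Γ), IsProbabilityMeasure m ∧ SMulInvariantMeasure G (CosetSpace Γ) m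

/-- `Γ` is a cocompact lattice in `G`: a lattice such that `Γ \ G` is compact. -/
def IsCocompactLattice {G : Type*} [Group G] [TopologicalSpace G] (Γ : Subgroup G) : Prop :=
  IsLattice Γ ∧ CompactSpace (CosetSpace Γ)

/-- `X ≃ Y` as `G`-spaces: there is a `G`-equivariant homeomorphism from `X` to `Y`. -/
def GSpaceIsomorphic (G X Y : Type*) [Group G] [TopologicalSpace X] [MulAction G X]
    [TopologicalSpace Y] [MulAction G Y] : Prop :=
  ∃ e : X ≃ₜ Y, ∀ (g : G) (x : X), e (g • x) = g • e x

/-- The convolution `(φ * f)(x) = ∫_G φ(g) f(g⁻¹ x) dg`, where `dg` is the measure `haar`. -/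
noncomputable def orbitConvolution {G X : Type*} [Group G] [MeasurableSpace G] [MulAction G X]
    (haar : Measure G) (φ : G → ℝ) (f : X → ℂ) (x : X) : ℂ :=
  ∫ g, (φ g : ℂ) * f (g⁻¹ • x) ∂haar

/-- The qualitative Sobolev embedding property of `(X, μ)`: for some `1 ≤ p < q ≤ ∞` and some
nonnegative continuous `φ ∈ L¹(G)`, not identically zero, convolution with `φ` maps
`Lᵖ(X, μ)` into `L^q(X, μ)`. -/
def QualitativeSobolevEmbedding {G X : Type*} [Group G] [TopologicalSpace G] [MeasurableSpace G]
    [MeasurableSpace X] [MulAction G X] (haar : Measure G) (μ : Measure X) : Prop :=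
  ∃ p q : ℝ≥0∞, 1 ≤ p ∧ p < q ∧
    ∃ φ : G → ℝ, Continuous φ ∧ (∀ g, 0 ≤ φ g) ∧ (∃ g, φ g ≠ 0) ∧ Integrable φ haar ∧
      ∀ f : X → ℂ, MemLp f p μ → MemLp (orbitConvolution haar φ f) q μ

/-! Smoothing by `φ` cannot raise integrability if small open sets `V` have thickenings `W • V` of
arbitrarily small measure. If such `V n` exist, with `m n = μ (W • V n)`, the `p`-th root of `∑ 2⁻ⁿ
/ m n` times the indicators of `W • (W • V n)` is in `Lᵖ`, while its convolution with `φ` has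
infinite `L^q` norm. Hence `μ (W • V)` is bounded below by some `δ` (`exists_pos_le_measure_smul`).

At most `1/δ` points can have disjoint translates by the compact set `closure W`, so a maximal such
family shows that finitely many compact pieces of orbits cover `X`
(`exists_finset_forall_mem_smul`). Thus `X` is compact and, being connected, a single orbit; by
Baire category it is `Γ \ G` with `Γ` a stabilizer.

It remains to see that `Γ` is discrete or open (`discreteTopology_or_isOpen_stabilizer`); an open
`Γ` makes `X` a point. A closed nondiscrete subgroup of `SL₂(ℝ)` contains a one-parameter subgroup.
The finite invariant measure prevents the subgroup from normalizing a line in `sl₂`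
(`exists_not_commute_adjointConj`), so conjugates of that one-parameter subgroup span `sl₂` and
generate a neighbourhood of the identity (`mem_nhds_one_of_forall_not_commute`). -/

open Set Filter Topology Pointwise
set_option linter.unusedSectionVars false

/-! ### Convolution of nonnegative functions along orbits -/

section Thickening

variable {G X : Type*} [Group G] [TopologicalSpace G] [IsTopologicalGroup G]
  [MeasurableSpace G] [BorelSpace G] [TopologicalSpace X] [MulAction G X] [ContinuousSMul G X]
  [MeasurableSpace X] [BorelSpace X]

/-- The extended nonnegative real version of the convolution along orbits. -/
noncomputable def orbitLConvolution (haar : Measure G) (φ : G → ℝ) (F : X → ℝ≥0∞) (x : X) : ℝ≥0∞ :=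
  ∫⁻ g, ENNReal.ofReal (φ g) * F (g⁻¹ • x) ∂haar

theorem setMeasure_le_orbitLConvolution (haar : Measure G) {φ : G → ℝ} {F : X → ℝ≥0∞}
    {ε : ℝ} {b : ℝ≥0∞} {O : Set G} (hOm : MeasurableSet O)
    (hO : ∀ g ∈ O, ε ≤ φ g) {x : X} (hF : ∀ g ∈ O, b ≤ F (g⁻¹ • x)) :
    ENNReal.ofReal ε * b * haar O ≤ orbitLConvolution haar φ F x := by
  rw [orbitLConvolution, ← setLIntegral_const]
  refine (setLIntegral_mono' hOm fun g hg => ?_).trans (setLIntegral_le_lintegral O _)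
  exact mul_le_mul' (ENNReal.ofReal_le_ofReal (hO g hg)) (hF g hg)

theorem measurable_inv_smul_uncurry [SecondCountableTopology G] :
    Measurable (fun z : G × X => z.1⁻¹ • z.2) := by
  have : Continuous (fun z : G × X => z.1⁻¹ • z.2) := by fun_prop
  exact this.measurable

theorem lintegral_orbitLConvolution [SecondCountableTopology G] (haar : Measure G) [SFinite haar]
    (μ : Measure X) [SFinite μ] [SMulInvariantMeasure G X μ] {φ : G → ℝ} (hφ : Continuous φ)
    {F : X → ℝ≥0∞} (hF : Measurable F) :
    ∫⁻ x, orbitLConvolution haar φ F x ∂μ =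
      (∫⁻ g, ENNReal.ofReal (φ g) ∂haar) * ∫⁻ x, F x ∂μ := by
  have hm : Measurable (fun z : X × G => ENNReal.ofReal (φ z.2) * F (z.2⁻¹ • z.1)) :=
    (hφ.measurable.comp measurable_snd).ennreal_ofReal.mul
      (hF.comp (measurable_inv_smul_uncurry.comp measurable_swap))
  simp only [orbitLConvolution]
  rw [lintegral_lintegral_swap hm.aemeasurable,
    ← lintegral_mul_const _ hφ.measurable.ennreal_ofReal]
  refine lintegral_congr fun g => ?_
  have hg : Measurable (fun x : X => g⁻¹ • x) := (continuous_const_smul g⁻¹).measurable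
  refine (lintegral_const_mul _ (hF.comp hg)).trans ?_
  congr 1
  exact (measurePreserving_smul g⁻¹ μ).lintegral_comp hF

/-- Where the extended convolution is finite, it computes the norm of the complex one. -/
theorem enorm_orbitConvolution [SecondCountableTopology G] (haar : Measure G)
    {φ : G → ℝ} (hφ : Continuous φ) (hφ0 : ∀ g, 0 ≤ φ g)
    {F : X → ℝ≥0∞} (hF : Measurable F) {x : X} (hx : orbitLConvolution haar φ F x ≠ ∞) :
    ‖orbitConvolution haar φ (fun y => ((F y).toReal : ℂ)) x‖ₑ = orbitLConvolution haar φ F x := by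
  have hg : Measurable (fun g : G => F (g⁻¹ • x)) :=
    hF.comp (measurable_inv_smul_uncurry.comp (measurable_id.prodMk measurable_const))
  have hm : Measurable (fun g : G => ENNReal.ofReal (φ g) * F (g⁻¹ • x)) :=
    hφ.measurable.ennreal_ofReal.mul hg
  have hlt := ae_lt_top hm hx
  have h1 : orbitConvolution haar φ (fun y => ((F y).toReal : ℂ)) x =
      ((∫ g, (ENNReal.ofReal (φ g) * F (g⁻¹ • x)).toReal ∂haar : ℝ) : ℂ) := by
    rw [orbitConvolution, ← integral_complex_ofReal]
    refine integral_congr_ae (Eventually.of_forall fun g => ?_)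
    simp [ENNReal.toReal_mul, ENNReal.toReal_ofReal (hφ0 g)]
  rw [h1, integral_toReal hm.aemeasurable hlt,
    ← ofReal_norm, Complex.norm_real, Real.norm_of_nonneg ENNReal.toReal_nonneg]
  exact ENNReal.ofReal_toReal hx

theorem memLp_toReal_rpow_inv (μ : Measure X) {p : ℝ≥0∞} (hp : p ≠ 0) (hp' : p ≠ ∞)
    {F : X → ℝ≥0∞} (hF : Measurable F) (hfin : ∫⁻ x, F x ∂μ ≠ ∞) :
    MemLp (fun y => ((F y ^ (p.toReal)⁻¹).toReal : ℂ)) p μ := by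
  have hp0 : 0 < p.toReal := ENNReal.toReal_pos hp hp'
  refine ⟨?_, ?_⟩
  · exact (Complex.measurable_ofReal.comp
      (hF.pow_const _).ennreal_toReal).aestronglyMeasurable
  · rw [eLpNorm_lt_top_iff_lintegral_rpow_enorm_lt_top hp hp']
    refine lt_of_le_of_lt (lintegral_mono fun y => ?_) hfin.lt_top
    have : ‖((F y ^ (p.toReal)⁻¹).toReal : ℂ)‖ₑ ≤ F y ^ (p.toReal)⁻¹ := by
      rw [← ofReal_norm, Complex.norm_real, Real.norm_of_nonneg ENNReal.toReal_nonneg]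
      exact ENNReal.ofReal_toReal_le
    calc _ ≤ (F y ^ (p.toReal)⁻¹) ^ p.toReal := ENNReal.rpow_le_rpow this hp0.le
      _ = F y := ENNReal.rpow_inv_rpow hp0.ne' _

end Thickening

/-! ### Lower bound for the measure of thickened open sets -/

section Thickening

variable {G X : Type*} [Group G] [TopologicalSpace G] [IsTopologicalGroup G]
  [MeasurableSpace G] [BorelSpace G] [TopologicalSpace X] [MulAction G X] [ContinuousSMul G X]
  [MeasurableSpace X] [BorelSpace X]

theorem exists_ne_top_measure_smul_smul_le (μ : Measure X) [SMulInvariantMeasure G X μ]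
    {W : Set G} (hW : IsOpen W) (h1 : 1 ∈ W) (hc : IsCompact (closure W)) :
    ∃ N : ℝ≥0∞, N ≠ ∞ ∧ ∀ V : Set X, μ (W • (W • V)) ≤ N * μ (W • V) := by
  -- `N` is the number of translates of `W` needed to cover `closure W * closure W`, hence
  -- independent of `V`.
  obtain ⟨t, ht⟩ := (hc.mul hc).elim_finite_subcover (fun g : G => g • W)
    (fun g => hW.smul g) (fun g _ => mem_iUnion.2 ⟨g, ⟨1, h1, by simp⟩⟩)
  refine ⟨t.card, ENNReal.natCast_ne_top _, fun V => ?_⟩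
  have hsub : W • (W • V) ⊆ ⋃ g ∈ t, g • (W • V) := by
    rintro _ ⟨a, ha, _, ⟨b, hb, v, hv, rfl⟩, rfl⟩
    have := ht (mul_mem_mul (subset_closure ha) (subset_closure hb))
    simp only [mem_iUnion] at this ⊢
    obtain ⟨g, hg, w, hw, hgw⟩ := this
    refine ⟨g, hg, w • v, smul_mem_smul hw hv, ?_⟩
    simp only [smul_eq_mul] at hgw ⊢
    rw [smul_smul, hgw, smul_smul]
  calc μ (W • (W • V)) ≤ ∑ g ∈ t, μ (g • (W • V)) :=
        (measure_mono hsub).trans (measure_biUnion_finset_le _ _)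
    _ = t.card * μ (W • V) := by simp [measure_smul]

/-- With `a = 1/p` and `b = 1/q`, the factor `m ^ (b - a) ≥ 4ⁿ` outweighs the loss `(2⁻ⁿ)ᵃ ≥ 2⁻ⁿ`.
-/
theorem two_pow_le_rpow_mul_rpow {m : ℝ≥0∞} (hm0 : m ≠ 0) (hm : m ≠ ∞) {a b : ℝ} (ha0 : 0 ≤ a)
    (ha : a ≤ 1) {n : ℕ} (hmn : m ^ (a - b) ≤ (4⁻¹) ^ n) :
    2 ^ n ≤ ((2⁻¹) ^ n / m) ^ a * m ^ b := by
  have h2 : ((2⁻¹ : ℝ≥0∞)) ^ n ≤ 1 := pow_le_one₀ zero_le (by simp)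
  have h3 : ((2⁻¹ : ℝ≥0∞)) ^ n ≤ ((2⁻¹ : ℝ≥0∞) ^ n) ^ a := by
    simpa using ENNReal.rpow_le_rpow_of_exponent_ge h2 ha
  have h4 : (m ^ a)⁻¹ * m ^ b = (m ^ (a - b))⁻¹ := by
    rw [← ENNReal.rpow_neg, ← ENNReal.rpow_neg, ← ENNReal.rpow_add _ _ hm0 hm]
    congr 1; ring
  rw [div_eq_mul_inv, ENNReal.mul_rpow_of_nonneg _ _ ha0, mul_assoc, ENNReal.inv_rpow, h4]
  calc (2 : ℝ≥0∞) ^ n = (2⁻¹) ^ n * ((4⁻¹) ^ n)⁻¹ := by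
        rw [← ENNReal.inv_pow, ← ENNReal.inv_pow, inv_inv,
          show (4 : ℝ≥0∞) = 2 * 2 by norm_num, mul_pow, ← mul_assoc, ENNReal.inv_mul_cancel,
          one_mul] <;> simp
    _ ≤ _ := mul_le_mul' h3 (ENNReal.inv_le_inv.2 hmn)

theorem exists_pos_le_measure_smul [SecondCountableTopology G] (haar : Measure G) [SFinite haar]
    (μ : Measure X) [IsProbabilityMeasure μ] [SMulInvariantMeasure G X μ] [μ.IsOpenPosMeasure]
    {p q : ℝ≥0∞} (hp : 1 ≤ p) (hpq : p < q) {φ : G → ℝ} (hφ : Continuous φ) (hφ0 : ∀ g, 0 ≤ φ g)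
    (hint : Integrable φ haar)
    (hSob : ∀ f : X → ℂ, MemLp f p μ → MemLp (orbitConvolution haar φ f) q μ)
    {W : Set G} (h1 : 1 ∈ W) {N : ℝ≥0∞} (hN : N ≠ ∞)
    (hWN : ∀ V : Set X, μ (W • (W • V)) ≤ N * μ (W • V)) {g₀ : G} {ε : ℝ} (hε : 0 < ε)
    {O : Set G} (hOm : MeasurableSet O) (hOW : ∀ g ∈ O, g⁻¹ * g₀ ∈ W)
    (hO : ∀ g ∈ O, ε ≤ φ g) (hO0 : haar O ≠ 0) :
    ∃ δ : ℝ≥0∞, δ ≠ 0 ∧ ∀ V : Set X, IsOpen V → V.Nonempty → δ ≤ μ (W • V) := by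
  have hp0 : p ≠ 0 := (zero_lt_one.trans_le hp).ne'
  have hpt : p ≠ ∞ := hpq.ne_top
  have hq0 : q ≠ 0 := (zero_le.trans_lt hpq).ne'
  have hp1 : 1 ≤ p.toReal := by
    simpa using (ENNReal.toReal_le_toReal ENNReal.one_ne_top hpt).2 hp
  have hpi : (p.toReal)⁻¹ ≤ 1 := inv_le_one_of_one_le₀ hp1
  have hpi0 : 0 < (p.toReal)⁻¹ := by positivity
  set a := (p.toReal)⁻¹
  -- For `q = ∞`, `q.toReal = 0` gives `b = 0`, the correct value of `1/q`.
  set b := 1 / q.toReal with hb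
  have hab : 0 < a - b := by
    rcases eq_or_ne q ∞ with rfl | hqt
    · simpa [hb] using hpi0
    · have := (ENNReal.toReal_lt_toReal hpt hqt).2 hpq
      rw [sub_pos, hb, one_div]
      exact inv_strictAnti₀ (by linarith) this
  by_contra! hcon
  have hch : ∀ n : ℕ, ∃ V : Set X, IsOpen V ∧ V.Nonempty ∧ μ (W • V) ^ (a - b) ≤ (4⁻¹) ^ n := by
    intro n
    obtain ⟨V, hV, hVn, hlt⟩ := hcon (((4⁻¹ : ℝ≥0∞) ^ n) ^ (a - b)⁻¹) (by
      simp [ENNReal.rpow_eq_zero_iff])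
    refine ⟨V, hV, hVn, ?_⟩
    have := ENNReal.rpow_le_rpow hlt.le hab.le
    rwa [ENNReal.rpow_inv_rpow hab.ne'] at this
  choose V hVo hVn hVm using hch
  set m : ℕ → ℝ≥0∞ := fun n => μ (W • V n) with hm
  have hm0 : ∀ n, m n ≠ 0 := fun n =>
    ((hVo n).smul_left.measure_pos μ (Set.Nonempty.smul ⟨1, h1⟩ (hVn n))).ne'
  have hmt : ∀ n, m n ≠ ∞ := fun n => measure_ne_top _ _
  -- The double thickening is needed because the convolution at a point of `g₀ • (W • V n)` samples
  -- `F` on `W • (W • V n)`; its measure is still at most `N * m n`, so `F` is integrable.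
  set F : X → ℝ≥0∞ := fun x =>
    ∑' n, (W • (W • V n)).indicator (fun _ => (2⁻¹ : ℝ≥0∞) ^ n / m n) x with hF
  have hAm : ∀ n, MeasurableSet (W • (W • V n)) := fun n => (hVo n).smul_left.smul_left.measurableSet
  have hFm : Measurable F := Measurable.tsum fun n => measurable_const.indicator (hAm n)
  have hFi : ∫⁻ x, F x ∂μ ≠ ∞ := by
    have : ∫⁻ x, F x ∂μ ≤ ∑' n, (2⁻¹ : ℝ≥0∞) ^ n * N := by
      rw [hF, lintegral_tsum fun n => (measurable_const.indicator (hAm n)).aemeasurable]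
      refine ENNReal.tsum_le_tsum fun n => ?_
      rw [lintegral_indicator_const (hAm n)]
      calc _ ≤ (2⁻¹ : ℝ≥0∞) ^ n / m n * (N * m n) := mul_le_mul_right (hWN _) _
        _ = (2⁻¹ : ℝ≥0∞) ^ n * N * ((m n)⁻¹ * m n) := by rw [div_eq_mul_inv]; ring
        _ = _ := by rw [ENNReal.inv_mul_cancel (hm0 n) (hmt n), mul_one]
    refine ne_top_of_le_ne_top ?_ this
    rw [ENNReal.tsum_mul_right, ENNReal.tsum_geometric]
    refine ENNReal.mul_ne_top ?_ hN
    simp [ENNReal.one_sub_inv_two]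
  have hbF : ∀ n, ∀ x ∈ W • (W • V n), (2⁻¹ : ℝ≥0∞) ^ n / m n ≤ F x := by
    intro n x hx
    refine le_trans ?_ (ENNReal.le_tsum n)
    rw [indicator_of_mem hx]
  have hFa : Measurable fun x => F x ^ a := hFm.pow_const _
  have hFai : ∫⁻ x, F x ^ a ∂μ ≠ ∞ := by
    -- Integrability of `F ^ a` makes the extended convolution finite almost everywhere, so that it
    -- agrees with the norm of the complex Bochner integral.
    have : ∫⁻ x, F x ^ a ∂μ ≤ ∫⁻ x, (1 + F x) ∂μ := by
      refine lintegral_mono fun x => ?_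
      rcases le_total (F x) 1 with h | h
      · exact (ENNReal.rpow_le_one h hpi0.le).trans le_self_add
      · refine le_trans ?_ le_add_self
        simpa using ENNReal.rpow_le_rpow_of_exponent_le h hpi
    refine ne_top_of_le_ne_top ?_ this
    rw [lintegral_add_left measurable_const]
    simp [hFi]
  have hfin : ∀ᵐ x ∂μ, orbitLConvolution haar φ (fun x => F x ^ a) x < ∞ := by
    have hne : ∫⁻ x, orbitLConvolution haar φ (fun x => F x ^ a) x ∂μ ≠ ∞ := by
      rw [lintegral_orbitLConvolution haar μ hφ hFa]
      exact ENNReal.mul_ne_top hint.lintegral_lt_top.ne hFai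
    refine ae_lt_top' ?_ hne
    refine (Measurable.lintegral_prod_right' (f := fun z : X × G =>
      ENNReal.ofReal (φ z.2) * F (z.2⁻¹ • z.1) ^ a) ?_).aemeasurable
    exact (hφ.measurable.comp measurable_snd).ennreal_ofReal.mul
      (hFa.comp (measurable_inv_smul_uncurry.comp measurable_swap))
  have hmem := hSob _ (memLp_toReal_rpow_inv μ hp0 hpt hFm hFi)
  set C := ENNReal.ofReal ε * haar O with hC
  have hC0 : C ≠ 0 := mul_ne_zero (by simpa using hε) hO0
  have hle : ∀ n : ℕ, C * 2 ^ n ≤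
      eLpNorm (orbitConvolution haar φ fun y => ((F y ^ a).toReal : ℂ)) q μ := by
    intro n
    have hBm : MeasurableSet (g₀ • (W • V n)) := ((hVo n).smul_left.smul g₀).measurableSet
    have hBμ : μ (g₀ • (W • V n)) = m n := measure_smul _ _ _
    calc C * 2 ^ n ≤ C * (((2⁻¹ : ℝ≥0∞) ^ n / m n) ^ a * m n ^ b) :=
          mul_le_mul_right (two_pow_le_rpow_mul_rpow (hm0 n) (hmt n) hpi0.le hpi (hVm n)) _
      _ = eLpNorm ((g₀ • (W • V n)).indicator
            fun _ => C * ((2⁻¹ : ℝ≥0∞) ^ n / m n) ^ a) q μ := by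
          rw [eLpNorm_indicator_const' hBm (by rw [hBμ]; exact hm0 n) hq0, hBμ, enorm_eq_self,
            mul_assoc C]
      _ ≤ _ := by
          refine eLpNorm_mono_enorm_ae ?_
          filter_upwards [hfin] with x hx
          rw [enorm_orbitConvolution haar hφ hφ0 hFa hx.ne, enorm_eq_self]
          by_cases hxB : x ∈ g₀ • (W • V n)
          · rw [indicator_of_mem hxB, hC, mul_right_comm]
            refine setMeasure_le_orbitLConvolution haar hOm hO fun g hg => ?_
            refine ENNReal.rpow_le_rpow (hbF n _ ?_) hpi0.le
            obtain ⟨y, hy, rfl⟩ := hxB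
            refine ⟨g⁻¹ * g₀, hOW g hg, y, hy, ?_⟩
            simp [mul_smul]
          · rw [indicator_of_notMem hxB]; exact zero_le
  have htop : Tendsto (fun n : ℕ => C * (2 : ℝ≥0∞) ^ n) atTop (𝓝 (C * ∞)) :=
    ENNReal.Tendsto.const_mul (ENNReal.tendsto_pow_atTop_nhds_top_iff.2 (by norm_num))
      (Or.inl ENNReal.top_ne_zero)
  rw [ENNReal.mul_top hC0] at htop
  exact hmem.2.not_ge (le_of_tendsto' htop hle)

/-- The qualitative Sobolev embedding property bounds from below the measures of the sets `W • V`,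
for a suitable relatively compact identity neighbourhood `W`. -/
theorem QualitativeSobolevEmbedding.exists_pos_le_measure_smul [SecondCountableTopology G]
    [LocallyCompactSpace G] (haar : Measure G) [haar.IsHaarMeasure] [SFinite haar]
    (μ : Measure X) [IsProbabilityMeasure μ] [SMulInvariantMeasure G X μ] [μ.IsOpenPosMeasure]
    (hSob : QualitativeSobolevEmbedding haar μ) :
    ∃ W : Set G, 1 ∈ W ∧ IsCompact (closure W) ∧
      ∃ δ : ℝ≥0∞, δ ≠ 0 ∧ ∀ V : Set X, IsOpen V → V.Nonempty → δ ≤ μ (W • V) := by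
  obtain ⟨p, q, hp, hpq, φ, hφ, hφ0, ⟨g₀, hg₀⟩, hint, hf⟩ := hSob
  have hpos : 0 < φ g₀ := (hφ0 g₀).lt_of_ne' hg₀
  have hU : IsOpen {w : G | φ g₀ / 2 < φ (g₀ * w⁻¹)} :=
    isOpen_lt continuous_const (by fun_prop)
  obtain ⟨K, hK, hKn⟩ := exists_compact_mem_nhds (1 : G)
  -- If `g⁻¹ * g₀ = w`, then `g = g₀ * w⁻¹`: membership of `g⁻¹ * g₀` in `W` bounds `φ g` below.
  set W := {w : G | φ g₀ / 2 < φ (g₀ * w⁻¹)} ∩ interior K with hWdef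
  have hW : IsOpen W := hU.inter isOpen_interior
  have h1 : 1 ∈ W := ⟨by simpa using hpos, mem_interior_iff_mem_nhds.2 hKn⟩
  have hWc : IsCompact (closure W) :=
    hK.closure_of_subset (inter_subset_right.trans interior_subset)
  obtain ⟨N, hN, hWN⟩ := exists_ne_top_measure_smul_smul_le μ hW h1 hWc
  have hO : IsOpen {g : G | g⁻¹ * g₀ ∈ W} := hW.preimage (by fun_prop)
  refine ⟨W, h1, hWc, _root_.exists_pos_le_measure_smul haar μ hp hpq hφ hφ0 hint hf h1 hN hWN
    (half_pos hpos) hO.measurableSet (fun g hg => hg) (fun g hg => ?_)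
    (hO.measure_pos haar ⟨g₀, by simpa using h1⟩).ne'⟩
  have := hg.1
  simp only [mem_ofPred_eq, mul_inv_rev, inv_inv, mul_inv_cancel_left] at this
  exact this.le

end Thickening

/-! ### Compactness and transitivity -/

section Transitivity

variable {G X : Type*} [Group G] [TopologicalSpace G]
  [TopologicalSpace X] [T2Space X] [MulAction G X] [ContinuousSMul G X]

theorem IsCompact.smul_singleton {C : Set G} (hC : IsCompact C) (x : X) :
    IsCompact (C • ({x} : Set X)) := hC.smul_set isCompact_singleton

/-- Disjoint compact sets in a Hausdorff space are separated by open sets, and compactness of `C`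
keeps `C • z'` inside them for all `z'` near the given point. -/
theorem exists_nhds_disjoint_smul {C : Set G} (hC : IsCompact C) {x y : X}
    (h : Disjoint (C • ({x} : Set X)) (C • {y})) :
    ∃ A ∈ 𝓝 x, ∃ B ∈ 𝓝 y, Disjoint (C • A) (C • B) := by
  obtain ⟨O₁, O₂, hO₁, hO₂, h₁, h₂, hd⟩ :=
    SeparatedNhds.of_isCompact_isCompact (hC.smul_singleton x) (hC.smul_singleton y) h
  have key : ∀ (z : X) (O : Set X), IsOpen O → C • ({z} : Set X) ⊆ O →
      {z' : X | ∀ c ∈ C, c • z' ∈ O} ∈ 𝓝 z := by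
    intro z O hO hz
    refine hC.eventually_forall_of_forall_eventually fun c hc => ?_
    exact (show Continuous fun w : X × G => w.2 • w.1 by fun_prop).continuousAt.eventually_mem
      (hO.mem_nhds (hz (smul_mem_smul hc rfl)))
  refine ⟨_, key x O₁ hO₁ h₁, _, key y O₂ hO₂ h₂, hd.mono ?_ ?_⟩
  · rintro _ ⟨c, hc, z, hz, rfl⟩; exact hz c hc
  · rintro _ ⟨c, hc, z, hz, rfl⟩; exact hz c hc

theorem exists_nhds_pairwiseDisjoint_smul {C : Set G} (hC : IsCompact C) (s : Finset X)
    (h : (s : Set X).PairwiseDisjoint fun x => C • ({x} : Set X)) :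
    ∃ V : X → Set X, (∀ x, IsOpen (V x) ∧ x ∈ V x) ∧
      (s : Set X).PairwiseDisjoint fun x => C • V x := by
  have hex : ∀ x y : X, ∃ A B : Set X, IsOpen A ∧ x ∈ A ∧ IsOpen B ∧ y ∈ B ∧
      (x ∈ s → y ∈ s → x ≠ y → Disjoint (C • A) (C • B)) := by
    intro x y
    by_cases hxy : x ∈ s ∧ y ∈ s ∧ x ≠ y
    · obtain ⟨A, hA, B, hB, hd⟩ := exists_nhds_disjoint_smul hC (h hxy.1 hxy.2.1 hxy.2.2)
      exact ⟨interior A, interior B, isOpen_interior, mem_interior_iff_mem_nhds.2 hA,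
        isOpen_interior, mem_interior_iff_mem_nhds.2 hB, fun _ _ _ => hd.mono
          (smul_subset_smul_left interior_subset) (smul_subset_smul_left interior_subset)⟩
    · exact ⟨univ, univ, isOpen_univ, mem_univ _, isOpen_univ, mem_univ _,
        fun h1 h2 h3 => (hxy ⟨h1, h2, h3⟩).elim⟩
  choose A B hA hxA hB hyB hd using hex
  refine ⟨fun x => ⋂ y ∈ s, (A x y ∩ B y x), fun x => ⟨?_, ?_⟩, ?_⟩
  · exact isOpen_biInter_finset fun y _ => (hA x y).inter (hB y x)
  · exact mem_iInter₂.2 fun y _ => ⟨hxA x y, hyB y x⟩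
  · intro x hx y hy hne
    refine (hd x y hx hy hne).mono (smul_subset_smul_left ?_) (smul_subset_smul_left ?_)
    · exact (biInter_subset_of_mem (Finset.mem_coe.2 hy)).trans inter_subset_left
    · exact (biInter_subset_of_mem (Finset.mem_coe.2 hx)).trans inter_subset_right

variable [MeasurableSpace X] [BorelSpace X]

theorem card_mul_le_of_pairwiseDisjoint_smul (μ : Measure X) [IsProbabilityMeasure μ]
    {W : Set G} (hc : IsCompact (closure W)) {δ : ℝ≥0∞}
    (hδ : ∀ V : Set X, IsOpen V → V.Nonempty → δ ≤ μ (W • V)) (s : Finset X)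
    (h : (s : Set X).PairwiseDisjoint fun x => closure W • ({x} : Set X)) :
    s.card * δ ≤ 1 := by
  obtain ⟨V, hV, hd⟩ := exists_nhds_pairwiseDisjoint_smul hc s h
  calc (s.card : ℝ≥0∞) * δ = ∑ x ∈ s, δ := by simp
    _ ≤ ∑ x ∈ s, μ (W • V x) := Finset.sum_le_sum fun x _ => hδ _ (hV x).1 ⟨x, (hV x).2⟩
    _ = μ (⋃ x ∈ s, W • V x) := by
        refine (measure_biUnion_finset (fun x hx y hy hne => (hd hx hy hne).mono
          (smul_subset_smul_right subset_closure) (smul_subset_smul_right subset_closure))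
          fun x _ => ((hV x).1.smul_left).measurableSet).symm
    _ ≤ 1 := prob_le_one

/-- If all sets `W • V` have measure bounded below then finitely many compact pieces of orbits
cover the space. -/
theorem exists_finset_forall_mem_smul [IsTopologicalGroup G]
    (μ : Measure X) [IsProbabilityMeasure μ]
    {W : Set G} (hc : IsCompact (closure W)) {δ : ℝ≥0∞} (hδ0 : δ ≠ 0)
    (hδ : ∀ V : Set X, IsOpen V → V.Nonempty → δ ≤ μ (W • V)) (hne : W.Nonempty) :
    ∃ s : Finset X, ∃ K : Set G, IsCompact K ∧ ∀ y : X, ∃ x ∈ s, y ∈ K • ({x} : Set X) := by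
  classical
  set C := closure W
  let P : ℕ → Prop := fun n => ∃ s : Finset X, s.card = n ∧
    (s : Set X).PairwiseDisjoint fun x => C • ({x} : Set X)
  obtain ⟨M, hM⟩ := ENNReal.exists_nat_mul_gt hδ0 ENNReal.one_ne_top
  have hbd : ∀ n, P n → n ≤ M := by
    rintro n ⟨s, rfl, hs⟩
    by_contra! hlt
    refine (card_mul_le_of_pairwiseDisjoint_smul μ hc hδ s hs).not_gt (hM.trans_le ?_)
    gcongr
  have hP : P (Nat.findGreatest P M) :=
    Nat.findGreatest_spec (m := 0) (Nat.zero_le _) ⟨∅, rfl, by simp⟩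
  obtain ⟨s, hs, hd⟩ := hP
  -- By maximality of `s`, `C • {y}` meets some `C • {x}`; from `a • y = b • x` follows `y = (a⁻¹ *
  -- b) • x`.
  refine ⟨s, C⁻¹ * C, hc.inv.mul hc, fun y => ?_⟩
  by_cases hys : y ∈ s
  · obtain ⟨w, hw⟩ := hne
    exact ⟨y, hys, w⁻¹ * w, mul_mem_mul (inv_mem_inv.2 (subset_closure hw)) (subset_closure hw),
      y, rfl, by simp⟩
  by_contra! hcon
  have : P (Nat.findGreatest P M + 1) := by
    refine ⟨insert y s, by rw [Finset.card_insert_of_notMem hys, hs], ?_⟩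
    rw [Finset.coe_insert]
    refine hd.insert fun x hx _ => ?_
    rw [Set.disjoint_left]
    rintro _ ⟨a, ha, y', hy', rfl⟩ ⟨b, hb, x', hx', hab⟩
    rw [mem_singleton_iff.1 hx', mem_singleton_iff.1 hy'] at hab
    refine hcon x hx ⟨a⁻¹ * b, mul_mem_mul (inv_mem_inv.2 ha) hb, x, rfl, ?_⟩
    simp only at hab ⊢
    rw [mul_smul, hab, inv_smul_smul]
  have := Nat.le_findGreatest (hbd _ this) this
  omega

theorem compactSpace_of_forall_mem_smul (s : Finset X) {K : Set G} (hK : IsCompact K)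
    (h : ∀ y : X, ∃ x ∈ s, y ∈ K • ({x} : Set X)) : CompactSpace X := by
  refine ⟨?_⟩
  have : (univ : Set X) = ⋃ x ∈ s, K • ({x} : Set X) := by
    ext y; simpa using h y
  rw [this]
  exact s.isCompact_biUnion fun x _ => hK.smul_singleton x

/-- Every invariant set is the union of the finitely many compact pieces based at its points of `s`,
hence closed. Applied to an orbit and to its complement, this makes orbits clopen. -/
theorem isPretransitive_of_forall_mem_smul [PreconnectedSpace X] (s : Finset X) {K : Set G}
    (hK : IsCompact K) (h : ∀ y : X, ∃ x ∈ s, y ∈ K • ({x} : Set X)) :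
    MulAction.IsPretransitive G X := by
  classical
  have hclosed : ∀ T : Set X, IsClosed (⋃ x ∈ s.filter (· ∈ T), K • ({x} : Set X)) := fun T =>
    ((s.filter (· ∈ T)).isCompact_biUnion fun x _ => hK.smul_singleton x).isClosed
  have hinv : ∀ T : Set X, (∀ (g : G) (x : X), x ∈ T ↔ g • x ∈ T) →
      (⋃ x ∈ s.filter (· ∈ T), K • ({x} : Set X)) = T := by
    intro T hT
    ext y
    simp only [mem_iUnion, Finset.mem_filter]
    constructor
    · rintro ⟨x, ⟨_, hxT⟩, k, hk, _, rfl, rfl⟩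
      exact (hT k _).1 hxT
    · intro hy
      obtain ⟨x, hx, hyx⟩ := h y
      refine ⟨x, ⟨hx, ?_⟩, hyx⟩
      obtain ⟨k, hk, _, rfl, rfl⟩ := hyx
      exact (hT k _).2 hy
  refine ⟨fun x y => ?_⟩
  have hT : ∀ (g : G) (z : X), z ∈ MulAction.orbit G x ↔ g • z ∈ MulAction.orbit G x :=
    fun g z => by
    rw [← MulAction.orbit_eq_iff, ← MulAction.orbit_eq_iff, MulAction.orbit_smul]
  have h1 : IsClosed (MulAction.orbit G x) := hinv _ hT ▸ hclosed (MulAction.orbit G x)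
  have h2 : IsClosed (MulAction.orbit G x)ᶜ :=
    hinv (MulAction.orbit G x)ᶜ (fun g z => not_congr (hT g z)) ▸ hclosed _
  have hu : MulAction.orbit G x = univ :=
    IsClopen.eq_univ ⟨h1, isClosed_compl_iff.1 h2⟩ ⟨x, MulAction.mem_orbit_self x⟩
  exact (hu ▸ mem_univ y : y ∈ MulAction.orbit G x)

end Transitivity

/-! ### Compact homogeneous spaces as coset spaces -/

section Homogeneous

variable {G X : Type*} [Group G] [TopologicalSpace G] [IsTopologicalGroup G]
  [TopologicalSpace X] [MulAction G X] [ContinuousSMul G X]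

/-- The map `Γ \ G → X`, `Γ a ↦ a⁻¹ • x`, where `Γ` is the stabilizer of `x`. -/
def CosetSpace.toOrbit (x : X) : CosetSpace (MulAction.stabilizer G x) → X :=
  Quotient.lift (fun a : G => a⁻¹ • x) (by
    intro a b h
    have h' : b * a⁻¹ ∈ MulAction.stabilizer G x := QuotientGroup.rightRel_apply.1 h
    rw [MulAction.mem_stabilizer_iff, mul_smul] at h'
    exact eq_inv_smul_iff.2 h')

theorem CosetSpace.toOrbit_mk (x : X) (a : G) :
    CosetSpace.toOrbit x (CosetSpace.mk (MulAction.stabilizer G x) a) = a⁻¹ • x := rfl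

theorem CosetSpace.continuous_mk (Γ : Subgroup G) : Continuous (CosetSpace.mk Γ) :=
  continuous_quot_mk

theorem CosetSpace.toOrbit_smul (x : X) (g : G) (z : CosetSpace (MulAction.stabilizer G x)) :
    CosetSpace.toOrbit x (g • z) = g • CosetSpace.toOrbit x z := by
  obtain ⟨a, rfl⟩ := CosetSpace.mk_surjective _ z
  rw [CosetSpace.smul_mk, CosetSpace.toOrbit_mk, CosetSpace.toOrbit_mk, mul_inv_rev, inv_inv,
    mul_smul]

theorem CosetSpace.bijective_toOrbit [MulAction.IsPretransitive G X] (x : X) :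
    Function.Bijective (CosetSpace.toOrbit (G := G) x) := by
  constructor
  · intro z w h
    obtain ⟨a, rfl⟩ := CosetSpace.mk_surjective _ z
    obtain ⟨b, rfl⟩ := CosetSpace.mk_surjective _ w
    rw [CosetSpace.toOrbit_mk, CosetSpace.toOrbit_mk, eq_inv_smul_iff] at h
    rw [CosetSpace.mk_eq_iff, MulAction.mem_stabilizer_iff, mul_smul, h]
  · intro y
    obtain ⟨g, rfl⟩ := MulAction.exists_smul_eq G x y
    exact ⟨CosetSpace.mk _ g⁻¹, by rw [CosetSpace.toOrbit_mk, inv_inv]⟩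

theorem CosetSpace.isHomeomorph_toOrbit [MulAction.IsPretransitive G X] (x : X)
    (ho : IsOpenMap fun g : G => g • x) : IsHomeomorph (CosetSpace.toOrbit (G := G) x) := by
  refine ⟨?_, ?_, CosetSpace.bijective_toOrbit x⟩
  · exact Continuous.quotient_lift (by fun_prop) _
  · intro U hU
    have h := (ho.comp (Homeomorph.inv G).isOpenMap) _
      (hU.preimage (CosetSpace.continuous_mk (MulAction.stabilizer G x)))
    convert h using 1
    ext y
    constructor
    · rintro ⟨z, hz, rfl⟩
      obtain ⟨a, rfl⟩ := CosetSpace.mk_surjective _ z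
      exact ⟨a, hz, rfl⟩
    · rintro ⟨a, ha, rfl⟩
      exact ⟨_, ha, rfl⟩

theorem exists_isCocompactLattice_of_discrete_stabilizer [CompactSpace X]
    [MulAction.IsPretransitive G X] [MeasurableSpace X] [BorelSpace X]
    (μ : Measure X) [IsProbabilityMeasure μ] [SMulInvariantMeasure G X μ] (x : X)
    (ho : IsOpenMap fun g : G => g • x) (hd : DiscreteTopology (MulAction.stabilizer G x)) :
    ∃ Γ : Subgroup G, IsCocompactLattice Γ ∧ GSpaceIsomorphic G X (CosetSpace Γ) := by
  let e := (CosetSpace.isHomeomorph_toOrbit x ho).homeomorph.symm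
  have he : ∀ (g : G) (y : X), e (g • y) = g • e y := by
    intro g y
    rw [Homeomorph.symm_apply_eq]
    refine Eq.trans ?_ (CosetSpace.toOrbit_smul x g _).symm
    exact congrArg (g • ·) (e.symm_apply_apply y).symm
  refine ⟨MulAction.stabilizer G x, ⟨⟨hd, μ.map e, ?_, ⟨?_⟩⟩, e.compactSpace⟩, e, he⟩
  · exact Measure.isProbabilityMeasure_map e.continuous.measurable.aemeasurable
  · intro g s hs
    have hcont : Continuous fun z : CosetSpace (MulAction.stabilizer G x) => g • z := by
      have : (fun z : CosetSpace (MulAction.stabilizer G x) => g • z) =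
          fun z => e (g • e.symm z) := by
        ext z; rw [he, e.apply_symm_apply]
      rw [this]
      exact e.continuous.comp ((continuous_const_smul g).comp e.symm.continuous)
    rw [Measure.map_apply e.continuous.measurable hs,
      Measure.map_apply e.continuous.measurable (hcont.measurable hs)]
    have : e ⁻¹' ((fun z => g • z) ⁻¹' s) = (fun y => g • y) ⁻¹' (e ⁻¹' s) := by
      ext y; simp [he]
    rw [this, measure_preimage_smul]

/-- The open orbit map sends the stabilizer onto `{x}`, which is therefore clopen. -/
theorem eq_of_isOpen_stabilizer [PreconnectedSpace X] [T1Space X] (x : X)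
    (ho : IsOpenMap fun g : G => g • x) (hs : IsOpen (MulAction.stabilizer G x : Set G)) (y : X) :
    y = x := by
  have h1 : IsOpen ({x} : Set X) := by
    convert ho _ hs
    ext z
    constructor
    · rintro rfl; exact ⟨1, one_mem _, one_smul _ _⟩
    · rintro ⟨g, hg, rfl⟩; exact hg
  have := IsClopen.eq_univ ⟨isClosed_singleton, h1⟩ ⟨x, rfl⟩
  exact mem_singleton_iff.1 (this ▸ mem_univ y)

end Homogeneous

/-! ### One-parameter subgroups of closed subgroups of `SL₂(ℝ)` -/

section OneParameter

open scoped Matrix.Norms.Operator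
open NormedSpace

local notation "SL2" => Matrix.SpecialLinearGroup (Fin 2) ℝ
local notation "M2" => Matrix (Fin 2) (Fin 2) ℝ

/-- By the inverse function theorem, `exp` maps each ball around `0` onto a neighbourhood of `1`. -/
theorem exists_mem_exp_eq_norm_lt {H : Subgroup SL2}
    (hnd : ∀ U ∈ 𝓝 (1 : SL2), ∃ h ∈ H, h ∈ U ∧ h ≠ 1) {ε : ℝ} (hε : 0 < ε) :
    ∃ w : M2, w ≠ 0 ∧ ‖w‖ < ε ∧ ∃ h ∈ H, (h : M2) = exp w := by
  have hd : HasStrictFDerivAt (exp : M2 → M2)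
      ((ContinuousLinearEquiv.refl ℝ M2 : M2 ≃L[ℝ] M2) : M2 →L[ℝ] M2) 0 :=
    hasStrictFDerivAt_exp_zero (𝕂 := ℝ)
  have hmap := hd.map_nhds_eq_of_equiv
  rw [exp_zero] at hmap
  have hU : exp '' Metric.ball (0 : M2) ε ∈ 𝓝 (1 : M2) := by
    have := image_mem_map (m := (exp : M2 → M2)) (Metric.ball_mem_nhds (0 : M2) hε)
    rwa [hmap] at this
  have hpre : (fun g : SL2 => (g : M2)) ⁻¹' (exp '' Metric.ball (0 : M2) ε) ∈ 𝓝 (1 : SL2) :=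
    Matrix.SpecialLinearGroup.isClosedEmbedding_val.continuous.continuousAt.preimage_mem_nhds
      (by simpa using hU)
  obtain ⟨h, hH, ⟨w, hw, hwh⟩, hne⟩ := hnd _ hpre
  refine ⟨w, ?_, by simpa using hw, h, hH, hwh.symm⟩
  rintro rfl
  rw [exp_zero] at hwh
  exact hne (Subtype.ext hwh.symm)

/-- Cartan's argument: take `exp (w n)` in `H` with `w n → 0`, and let `v` be a limit direction of
the `w n`. The powers with exponent `⌊t / ‖w n‖⌋₊` converge along the subsequence to `exp (t • v)`,
and `H` is closed. -/
theorem exists_exp_smul_mem {H : Subgroup SL2} (hc : IsClosed (H : Set SL2))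
    (hnd : ∀ U ∈ 𝓝 (1 : SL2), ∃ h ∈ H, h ∈ U ∧ h ≠ 1) :
    ∃ v : M2, v ≠ 0 ∧ ∀ t : ℝ, ∃ h ∈ H, (h : M2) = exp (t • v) := by
  have hex : ∀ n : ℕ, ∃ w : M2, w ≠ 0 ∧ ‖w‖ < 1 / ((n : ℝ) + 1) ∧ ∃ h ∈ H, (h : M2) = exp w :=
    fun n => exists_mem_exp_eq_norm_lt hnd (by positivity)
  choose w hw0 hwn hwH using hex
  have hw : Tendsto (fun n => ‖w n‖) atTop (𝓝 0) :=
    squeeze_zero (fun n => norm_nonneg _) (fun n => (hwn n).le) tendsto_one_div_add_atTop_nhds_zero_nat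
  have hnpos : ∀ n, 0 < ‖w n‖ := fun n => norm_pos_iff.2 (hw0 n)
  have hsph : ∀ n, ‖w n‖⁻¹ • w n ∈ Metric.sphere (0 : M2) 1 := by
    intro n
    rw [mem_sphere_zero_iff_norm, norm_smul, norm_inv, norm_norm,
      inv_mul_cancel₀ (hnpos n).ne']
  obtain ⟨v, hv, σ, hσ, hlim⟩ := (isCompact_sphere (0 : M2) 1).tendsto_subseq hsph
  refine ⟨v, ?_, ?_⟩
  · rintro rfl; simp at hv
  have hcl : IsClosed ((fun g : SL2 => (g : M2)) '' (H : Set SL2)) :=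
    Matrix.SpecialLinearGroup.isClosedEmbedding_val.isClosedMap _ hc
  have hpos : ∀ t : ℝ, 0 ≤ t → ∃ h ∈ H, (h : M2) = exp (t • v) := by
    intro t ht
    have hk : Tendsto (fun n => (⌊t / ‖w (σ n)‖⌋₊ : ℝ) * ‖w (σ n)‖) atTop (𝓝 t) := by
      have h0 : Tendsto (fun n => ‖w (σ n)‖) atTop (𝓝 0) := hw.comp hσ.tendsto_atTop
      refine tendsto_of_tendsto_of_tendsto_of_le_of_le (g := fun n => t - ‖w (σ n)‖)
        (by simpa using tendsto_const_nhds.sub h0) tendsto_const_nhds (fun n => ?_) (fun n => ?_)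
      · have := (Nat.lt_floor_add_one (t / ‖w (σ n)‖)).le
        rw [div_le_iff₀ (hnpos _)] at this
        simp only
        linarith
      · have := Nat.floor_le (div_nonneg ht (hnpos (σ n)).le)
        rwa [le_div_iff₀ (hnpos _)] at this
    have hlim' : Tendsto (fun n => exp (⌊t / ‖w (σ n)‖⌋₊ • w (σ n))) atTop (𝓝 (exp (t • v))) := by
      refine ((exp_continuous (𝔸 := M2)).tendsto _).comp ?_
      refine (hk.smul hlim).congr fun n => ?_
      simp only [Function.comp]
      rw [smul_smul, mul_assoc, mul_inv_cancel₀ (hnpos _).ne', mul_one, Nat.cast_smul_eq_nsmul]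
    have hmem := hcl.mem_of_tendsto hlim' (Eventually.of_forall fun n => by
      obtain ⟨h, hH, he⟩ := hwH (σ n)
      refine ⟨h ^ ⌊t / ‖w (σ n)‖⌋₊, pow_mem hH _, ?_⟩
      simp only
      rw [Matrix.SpecialLinearGroup.coe_pow, he, Matrix.exp_nsmul])
    obtain ⟨h, hH, he⟩ := hmem
    exact ⟨h, hH, he⟩
  intro t
  rcases le_total 0 t with ht | ht
  · exact hpos t ht
  · obtain ⟨h, hH, he⟩ := hpos (-t) (by linarith)
    refine ⟨h⁻¹, inv_mem hH, ?_⟩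
    have h1 : (h : M2) * (h⁻¹ : SL2) = 1 := by
      rw [← Matrix.SpecialLinearGroup.coe_mul, mul_inv_cancel, Matrix.SpecialLinearGroup.coe_one]
    rw [← neg_neg t, neg_smul, Matrix.exp_neg, ← he]
    exact (Matrix.inv_eq_right_inv h1).symm

theorem trace_eq_zero_of_det_exp_smul {v : M2} (h : ∀ t : ℝ, (exp (t • v)).det = 1) :
    v.trace = 0 := by
  have hd := hasDerivAt_exp_smul_const (𝕂 := ℝ) v (0 : ℝ)
  rw [zero_smul, exp_zero, one_mul] at hd
  have he : ∀ i j, HasDerivAt (fun t : ℝ => exp (t • v) i j) (v i j) 0 := fun i j =>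
    (hasDerivAt_pi.1 (hasDerivAt_pi.1 hd i) j)
  have h1 := ((he 0 0).mul (he 1 1)).sub ((he 0 1).mul (he 1 0))
  have h2 : HasDerivAt (fun _ : ℝ => (1 : ℝ)) 0 0 := hasDerivAt_const _ _
  have h3 := h1.unique (h2.congr_of_eventuallyEq (Eventually.of_forall fun t => by
    simpa [Matrix.det_fin_two] using h t))
  simpa [Matrix.trace_fin_two, exp_zero, add_comm] using h3

/-- Three one-parameter subgroups whose directions together with the identity span the matrices
generate a neighbourhood of the identity. -/
theorem mem_nhds_one_of_exp_smul_mem {H : Subgroup SL2} {v₁ v₂ v₃ : M2}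
    (h₁ : ∀ t : ℝ, ∃ h ∈ H, (h : M2) = exp (t • v₁))
    (h₂ : ∀ t : ℝ, ∃ h ∈ H, (h : M2) = exp (t • v₂))
    (h₃ : ∀ t : ℝ, ∃ h ∈ H, (h : M2) = exp (t • v₃))
    (hspan : ∀ m : M2, ∃ a b c d : ℝ, a • v₁ + b • v₂ + c • v₃ + d • 1 = m) :
    (H : Set SL2) ∈ 𝓝 1 := by
  -- The scalar factor supplies the direction transverse to `sl₂`, so that surjectivity of the
  -- derivative can be used in the full matrix space; determinant one then forces this factor to be
  -- `1`.
  let Φ : (Fin 4 → ℝ) → M2 := fun x =>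
    exp (x 0 • v₁) * exp (x 1 • v₂) * exp (x 2 • v₃) * (Real.exp (x 3) • 1)
  have hE : ∀ (v : M2) (i : Fin 4), HasStrictFDerivAt (fun x : Fin 4 → ℝ => exp (x i • v))
      ((ContinuousLinearMap.proj (R := ℝ) (φ := fun _ : Fin 4 => ℝ) i).smulRight v) 0 := by
    intro v i
    have h := (hasStrictDerivAt_exp_smul_const (𝕂 := ℝ) v (0 : ℝ)).hasStrictFDerivAt
    rw [zero_smul, exp_zero, one_mul] at h
    exact HasStrictFDerivAt.comp (f := fun x : Fin 4 → ℝ => x i) (0 : Fin 4 → ℝ) h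
      (ContinuousLinearMap.proj (R := ℝ) (φ := fun _ : Fin 4 => ℝ) i).hasStrictFDerivAt
  have hR : HasStrictFDerivAt (fun x : Fin 4 → ℝ => Real.exp (x 3) • (1 : M2))
      ((ContinuousLinearMap.proj (R := ℝ) (φ := fun _ : Fin 4 => ℝ) 3).smulRight (1 : M2)) 0 := by
    have h := ((Real.hasStrictDerivAt_exp (0 : ℝ)).smul_const (1 : M2)).hasStrictFDerivAt
    rw [Real.exp_zero, one_smul] at h
    exact HasStrictFDerivAt.comp (f := fun x : Fin 4 → ℝ => x 3) (0 : Fin 4 → ℝ) h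
      (ContinuousLinearMap.proj (R := ℝ) (φ := fun _ : Fin 4 => ℝ) 3).hasStrictFDerivAt
  have hΦ := (((hE v₁ 0).mul' (hE v₂ 1)).mul' (hE v₃ 2)).mul' hR
  have hmap := hΦ.map_nhds_eq_of_surj (by
    rw [LinearMap.range_eq_top]
    intro m
    obtain ⟨a, b, c, d, hm⟩ := hspan m
    refine ⟨![a, b, c, d], ?_⟩
    change ((exp ((0 : ℝ) • v₁) * exp ((0 : ℝ) • v₂)) * exp ((0 : ℝ) • v₃)) * (d • 1) +
      ((exp ((0 : ℝ) • v₁) * exp ((0 : ℝ) • v₂)) * (c • v₃) + (exp ((0 : ℝ) • v₁) * (b • v₂) +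
        (a • v₁) * exp ((0 : ℝ) • v₂)) * exp ((0 : ℝ) • v₃)) * (Real.exp 0 • 1) = m
    rw [← hm]
    simp only [zero_smul, exp_zero, one_mul, mul_one, Real.exp_zero, one_smul]
    abel)
  have hΦ0 : Φ 0 = 1 := by simp [Φ, exp_zero]
  have hΦH : ∀ x, (Φ x).det = 1 → ∃ h ∈ H, (h : M2) = Φ x := by
    intro x hx
    obtain ⟨g₁, hg₁, e₁⟩ := h₁ (x 0)
    obtain ⟨g₂, hg₂, e₂⟩ := h₂ (x 1)
    obtain ⟨g₃, hg₃, e₃⟩ := h₃ (x 2)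
    have hx' : Φ x = (g₁ : M2) * g₂ * g₃ * (Real.exp (x 3) • 1) := by rw [e₁, e₂, e₃]
    have h1 : Real.exp (x 3) = 1 := by
      rw [hx'] at hx
      simp only [Matrix.det_mul, Matrix.SpecialLinearGroup.det_coe, one_mul, Matrix.det_smul,
        Matrix.det_one, mul_one, Fintype.card_fin] at hx
      exact (pow_eq_one_iff_of_nonneg (Real.exp_pos _).le two_ne_zero).1 hx
    refine ⟨g₁ * g₂ * g₃, mul_mem (mul_mem hg₁ hg₂) hg₃, ?_⟩
    rw [hx', h1, one_smul, mul_one]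
    simp
  have hU : range Φ ∈ 𝓝 (1 : M2) := by
    have := range_mem_map (m := Φ) (f := 𝓝 0)
    change map Φ (𝓝 0) = 𝓝 (Φ 0) at hmap
    rwa [hmap, hΦ0] at this
  have hpre : (fun g : SL2 => (g : M2)) ⁻¹' (range Φ) ∈ 𝓝 (1 : SL2) :=
    Matrix.SpecialLinearGroup.isClosedEmbedding_val.continuous.continuousAt.preimage_mem_nhds
      (by simpa using hU)
  filter_upwards [hpre] with g hg
  obtain ⟨x, hx⟩ := hg
  simp only at hx
  obtain ⟨h, hH, he⟩ := hΦH x (by rw [hx]; simp)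
  have : g = h := Subtype.ext (hx.symm.trans he.symm)
  rw [this]; exact hH

end OneParameter

/-! ### Adjoint action and Borel density for `SL₂(ℝ)` -/

section Density

local notation "SL2" => Matrix.SpecialLinearGroup (Fin 2) ℝ
local notation "M2" => Matrix (Fin 2) (Fin 2) ℝ

theorem Matrix.eq_of_trace_eq_zero_fin_two {m : M2} (h : m.trace = 0) :
    m = !![m 0 0, m 0 1; m 1 0, -m 0 0] := by
  rw [Matrix.trace_fin_two] at h
  ext i j
  fin_cases i <;> fin_cases j <;> simp
  linarith

/-- The adjoint action of `SL₂(ℝ)` on matrices. -/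
def adjointConj (g : SL2) (m : M2) : M2 := (g : M2) * m * ((g⁻¹ : SL2) : M2)

theorem adjointConj_mul (g h : SL2) (m : M2) :
    adjointConj (g * h) m = adjointConj g (adjointConj h m) := by
  simp only [adjointConj, mul_inv_rev, Matrix.SpecialLinearGroup.coe_mul, mul_assoc]

theorem coe_inv_mul_coe (g : SL2) : ((g⁻¹ : SL2) : M2) * (g : M2) = 1 := by
  rw [← Matrix.SpecialLinearGroup.coe_mul, inv_mul_cancel, Matrix.SpecialLinearGroup.coe_one]

theorem coe_mul_coe_inv (g : SL2) : (g : M2) * ((g⁻¹ : SL2) : M2) = 1 := by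
  rw [← Matrix.SpecialLinearGroup.coe_mul, mul_inv_cancel, Matrix.SpecialLinearGroup.coe_one]

theorem adjointConj_mul_matrix (g : SL2) (m n : M2) :
    adjointConj g (m * n) = adjointConj g m * adjointConj g n := by
  simp only [adjointConj]
  calc (g : M2) * (m * n) * ((g⁻¹ : SL2) : M2)
      = (g : M2) * m * 1 * n * ((g⁻¹ : SL2) : M2) := by simp only [mul_one, mul_assoc]
    _ = _ := by rw [← coe_inv_mul_coe g]; simp only [mul_assoc]

theorem trace_adjointConj (g : SL2) (m : M2) : (adjointConj g m).trace = m.trace := by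
  rw [adjointConj, Matrix.trace_mul_comm, ← mul_assoc, coe_inv_mul_coe, one_mul]

theorem adjointConj_one (m : M2) : adjointConj 1 m = m := by simp [adjointConj]

theorem trace_adjointConj_mul (g : SL2) (m n : M2) :
    (adjointConj g m * n).trace = (m * adjointConj g⁻¹ n).trace := by
  rw [← trace_adjointConj g (m * adjointConj g⁻¹ n), adjointConj_mul_matrix, ← adjointConj_mul,
    mul_inv_cancel, adjointConj_one]

theorem Commute.adjointConj {m n : M2} (h : Commute m n) (g : SL2) :
    Commute (adjointConj g m) (adjointConj g n) := by
  rw [Commute, SemiconjBy, ← adjointConj_mul_matrix, ← adjointConj_mul_matrix, h.eq]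

theorem continuous_adjointConj (m : M2) : Continuous fun g : SL2 => adjointConj g m := by
  have h := (Matrix.SpecialLinearGroup.isClosedEmbedding_val (n := Fin 2) (R := ℝ)).continuous
  exact (h.mul continuous_const).mul (h.comp (continuous_inv (G := SL2)))

theorem adjointConj_mk {a b c d : ℝ} (h : (!![a, b; c, d] : M2).det = 1) (m : M2) :
    adjointConj ⟨!![a, b; c, d], h⟩ m = !![a, b; c, d] * m * !![d, -b; -c, a] := by
  have hinv : (((⟨!![a, b; c, d], h⟩ : SL2)⁻¹ : SL2) : M2) = !![d, -b; -c, a] :=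
    (Matrix.SpecialLinearGroup.coe_inv _).trans (Matrix.adjugate_fin_two_of a b c d)
  exact congrArg (!![a, b; c, d] * m * ·) hinv

/-- The upper unipotent matrix with off-diagonal entry `s`. -/
def upperUnipotent (s : ℝ) : SL2 := ⟨!![1, s; 0, 1], by simp [Matrix.det_fin_two]⟩

/-- Consequently the ratio of entry `(0, 0)` to entry `(1, 0)` is shifted by `s`. -/
theorem adjointConj_upperUnipotent_apply (m : M2) (s : ℝ) :
    adjointConj (upperUnipotent s) m 1 0 = m 1 0 ∧
      adjointConj (upperUnipotent s) m 0 0 = m 0 0 + s * m 1 0 := by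
  rw [upperUnipotent, adjointConj_mk]
  simp only [Matrix.mul_apply, Fin.sum_univ_two, Matrix.of_apply, Matrix.cons_val', Matrix.cons_val_zero,
    Matrix.cons_val_one, Matrix.cons_val_fin_one]
  constructor <;> ring

theorem exists_adjointConj_one_zero_ne {u : M2} (hu : u ≠ 0) (ht : u.trace = 0) :
    ∃ g : SL2, adjointConj g u 1 0 ≠ 0 := by
  rw [Matrix.trace_fin_two] at ht
  by_cases hz : u 1 0 = 0
  · by_cases hy : u 0 1 = 0
    · have hx : u 0 0 ≠ 0 := by
        intro hx
        apply hu
        ext i j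
        fin_cases i <;> fin_cases j <;> simp [hx, hy, hz]
        linarith
      refine ⟨⟨!![1, 0; 1, 1], by simp [Matrix.det_fin_two]⟩, ?_⟩
      have h11 : u 1 1 = -u 0 0 := by linarith
      rw [adjointConj_mk]
      simp only [Matrix.mul_apply, Fin.sum_univ_two, Matrix.of_apply, Matrix.cons_val', Matrix.cons_val_zero,
        Matrix.cons_val_one, Matrix.cons_val_fin_one, hz, hy, h11]
      intro h
      apply hx
      linarith
    · refine ⟨⟨!![0, -1; 1, 0], by simp [Matrix.det_fin_two]⟩, ?_⟩
      rw [adjointConj_mk]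
      simp only [Matrix.mul_apply, Fin.sum_univ_two, Matrix.of_apply, Matrix.cons_val', Matrix.cons_val_zero,
        Matrix.cons_val_one, Matrix.cons_val_fin_one]
      intro h
      apply hy
      linarith
  · exact ⟨1, by rwa [adjointConj_one]⟩

/-- The condition says that the ratio `x / z` lies in `(0, 1)`, phrased without division. Once `z ≠
0`, a unipotent shift brings the ratio to `1 / 2`. -/
theorem exists_adjointConj_mem_strip {u : M2} (hu : u ≠ 0) (ht : u.trace = 0) :
    ∃ g : SL2, 0 < adjointConj g u 0 0 * adjointConj g u 1 0 ∧
      adjointConj g u 0 0 * adjointConj g u 1 0 < adjointConj g u 1 0 ^ 2 := by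
  obtain ⟨g, hg⟩ := exists_adjointConj_one_zero_ne hu ht
  set x := adjointConj g u 0 0
  set z := adjointConj g u 1 0
  refine ⟨upperUnipotent (1 / 2 - x / z) * g, ?_⟩
  obtain ⟨h1, h2⟩ := adjointConj_upperUnipotent_apply (adjointConj g u) (1 / 2 - x / z)
  rw [adjointConj_mul, h1, h2]
  have h3 : (x + (1 / 2 - x / z) * z) * z = z ^ 2 / 2 := by field_simp; ring
  have hz : 0 < z ^ 2 := by positivity
  change 0 < (x + (1 / 2 - x / z) * z) * z ∧ (x + (1 / 2 - x / z) * z) * z < z ^ 2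
  rw [h3]
  constructor <;> linarith

theorem eq_of_strip_translates {x z x' z' : ℝ} {k l : ℕ} (h1 : 0 < x * z) (h2 : x * z < z ^ 2)
    (h1' : 0 < x' * z') (h2' : x' * z' < z' ^ 2)
    (h : (x + k * z) * z' = z * (x' + l * z')) : k = l := by
  have hz : z ≠ 0 := by rintro rfl; simp at h1
  have hz' : z' ≠ 0 := by rintro rfl; simp at h1'
  have hr : ∀ {x z : ℝ}, z ≠ 0 → 0 < x * z → x * z < z ^ 2 → 0 < x / z ∧ x / z < 1 := by
    intro x z hz h1 h2
    have hz2 : 0 < z ^ 2 := by positivity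
    have : x / z = x * z / z ^ 2 := by field_simp
    rw [this]
    exact ⟨by positivity, (div_lt_one hz2).2 h2⟩
  have e : x / z + k = x' / z' + l := by field_simp; linarith
  obtain ⟨a, b⟩ := hr hz h1 h2
  obtain ⟨a', b'⟩ := hr hz' h1' h2'
  have c1 : (k : ℝ) < l + 1 := by linarith
  have c2 : (l : ℝ) < k + 1 := by linarith
  have c1' : k < l + 1 := by exact_mod_cast c1
  have c2' : l < k + 1 := by exact_mod_cast c2
  omega

/-- Commuting traceless matrices are proportional when nonzero; only equality of the ratios of these
two entries is needed. -/
theorem commute_fin_two_apply {m n : M2} (hm : m.trace = 0) (hn : n.trace = 0)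
    (h : Commute m n) : m 0 0 * n 1 0 = m 1 0 * n 0 0 := by
  have := congrFun (congrFun h.eq 1) 0
  rw [Matrix.trace_fin_two] at hm hn
  simp only [Matrix.mul_apply, Fin.sum_univ_two] at this
  linear_combination (-1 / 2) * this + 1 / 2 * n 1 0 * hm - 1 / 2 * m 1 0 * hn

/-- A stabilizer of finite covolume does not normalize a line of traceless matrices: translates
by unipotents of a suitable open set would be disjoint. -/
theorem exists_not_commute_adjointConj {X : Type*} [TopologicalSpace X] [MulAction SL2 X]
    [ContinuousConstSMul SL2 X] [MeasurableSpace X] [BorelSpace X] (μ : Measure X)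
    [IsFiniteMeasure μ] [SMulInvariantMeasure SL2 X μ] [μ.IsOpenPosMeasure] (x₀ : X)
    (ho : IsOpenMap fun g : SL2 => g • x₀) {u : M2} (hu : u ≠ 0) (ht : u.trace = 0) :
    ∃ h ∈ MulAction.stabilizer SL2 x₀, ¬ Commute (adjointConj h u) u := by
  -- Otherwise the line spanned by `adjointConj g u` depends only on `g • x₀`, so the ratio of
  -- entries becomes a function on part of `X`, and integer unipotent shifts move the strip `(0, 1)`
  -- to disjoint sets of equal positive measure.
  by_contra! hcon
  set T : Set SL2 := {g | 0 < adjointConj g u 0 0 * adjointConj g u 1 0 ∧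
    adjointConj g u 0 0 * adjointConj g u 1 0 < adjointConj g u 1 0 ^ 2} with hT
  have hTo : IsOpen T := by
    have hc := continuous_adjointConj u
    have h0 : Continuous fun g : SL2 => adjointConj g u 0 0 := hc.matrix_elem 0 0
    have h1 : Continuous fun g : SL2 => adjointConj g u 1 0 := hc.matrix_elem 1 0
    exact (isOpen_lt continuous_const (h0.mul h1)).inter (isOpen_lt (h0.mul h1) (h1.pow 2))
  set U : Set X := (fun g : SL2 => g • x₀) '' T with hU
  have hUo : IsOpen U := ho _ hTo
  have hUpos : 0 < μ U := hUo.measure_pos μ (Set.Nonempty.image _ (exists_adjointConj_mem_strip hu ht))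
  have hdisj : Pairwise (Function.onFun Disjoint fun k : ℕ => upperUnipotent k • U) := by
    intro k l hkl
    rw [Function.onFun, Set.disjoint_left]
    rintro _ ⟨_, ⟨g, hg, rfl⟩, rfl⟩ ⟨_, ⟨g', hg', rfl⟩, he⟩
    apply hkl
    simp only [smul_smul] at he
    set a := upperUnipotent k * g with ha
    set b := upperUnipotent l * g' with hb
    have hmem : b⁻¹ * a ∈ MulAction.stabilizer SL2 x₀ := by
      rw [MulAction.mem_stabilizer_iff, mul_smul, ← he, inv_smul_smul]
    have hcomm := (hcon _ hmem).adjointConj b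
    rw [← adjointConj_mul, mul_inv_cancel_left] at hcomm
    have htr : ∀ g : SL2, (adjointConj g u).trace = 0 := fun g => (trace_adjointConj g u).trans ht
    have key := commute_fin_two_apply (htr a) (htr b) hcomm
    obtain ⟨p1, p2⟩ := adjointConj_upperUnipotent_apply (adjointConj g u) k
    obtain ⟨q1, q2⟩ := adjointConj_upperUnipotent_apply (adjointConj g' u) l
    rw [ha, hb, adjointConj_mul, adjointConj_mul, p1, p2, q1, q2] at key
    exact eq_of_strip_translates hg.1 hg.2 hg'.1 hg'.2 key
  have hsum : μ (⋃ k : ℕ, upperUnipotent k • U) = ∞ := by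
    rw [measure_iUnion hdisj fun k => (hUo.smul _).measurableSet]
    simp only [measure_smul]
    exact ENNReal.tsum_const_eq_top_of_ne_zero hUpos.ne'
  exact measure_ne_top μ _ hsum

/-- This is the triple product identity `[u, [v, w]] = 2 tr(uv) w - 2 tr(uw) v` in `sl₂`. -/
theorem commute_of_trace_mul_eq_zero {u v w : M2} (hu : u.trace = 0) (hv : v.trace = 0)
    (hw : w.trace = 0) (h1 : (u * v).trace = 0) (h2 : (u * w).trace = 0) :
    Commute u (v * w - w * v) := by
  rw [Matrix.eq_of_trace_eq_zero_fin_two hu, Matrix.eq_of_trace_eq_zero_fin_two hv] at *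
  rw [Matrix.eq_of_trace_eq_zero_fin_two hw] at *
  simp [Matrix.trace_fin_two] at h1 h2
  generalize u 0 0 = a at *
  generalize u 0 1 = b at *
  generalize u 1 0 = c at *
  generalize v 0 0 = a' at *
  generalize v 0 1 = b' at *
  generalize v 1 0 = c' at *
  generalize w 0 0 = a'' at *
  generalize w 0 1 = b'' at *
  generalize w 1 0 = c'' at *
  rw [Commute, SemiconjBy]
  ext i j
  fin_cases i <;> fin_cases j <;> simp [Matrix.mul_apply, Fin.sum_univ_two]
  · linear_combination 2 * a'' * h1 - 2 * a' * h2
  · linear_combination 2 * b'' * h1 - 2 * b' * h2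
  · linear_combination 2 * c'' * h1 - 2 * c' * h2
  · linear_combination -2 * a'' * h1 + 2 * a' * h2

/-- Cramer's rule: the commutator plays the role of the cross product, `tr([u, v] w)` that of the
determinant, and `d` accounts for the trace of `m`. -/
theorem exists_smul_add_eq_of_trace_ne_zero {u v w : M2} (hu : u.trace = 0) (hv : v.trace = 0)
    (hw : w.trace = 0) (hT : ((u * v - v * u) * w).trace ≠ 0) (m : M2) :
    ∃ a b c d : ℝ, a • u + b • v + c • w + d • 1 = m := by
  set T := ((u * v - v * u) * w).trace with hTdef
  refine ⟨((v * w - w * v) * m).trace / T, ((w * u - u * w) * m).trace / T,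
    ((u * v - v * u) * m).trace / T, m.trace / 2, ?_⟩
  have key : ((v * w - w * v) * m).trace • u + ((w * u - u * w) * m).trace • v +
      ((u * v - v * u) * m).trace • w = T • (m - (m.trace / 2) • 1) := by
    rw [hTdef]
    rw [Matrix.trace_fin_two] at hu hv hw
    have hu' : u 1 1 = -u 0 0 := by linarith
    have hv' : v 1 1 = -v 0 0 := by linarith
    have hw' : w 1 1 = -w 0 0 := by linarith
    ext i j
    fin_cases i <;> fin_cases j <;>
      simp [Matrix.trace_fin_two, Matrix.mul_apply, Fin.sum_univ_two, hu', hv', hw'] <;> ring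
  have h2 : m - (m.trace / 2) • 1 = T⁻¹ • (T • (m - (m.trace / 2) • (1 : M2))) := by
    rw [smul_smul, inv_mul_cancel₀ hT, one_smul]
  rw [← eq_sub_iff_add_eq, h2, ← key]
  simp only [smul_add, smul_smul, div_eq_inv_mul]

theorem exp_smul_adjointConj_mem {H : Subgroup SL2} {v : M2}
    (hv : ∀ t : ℝ, ∃ h ∈ H, (h : M2) = NormedSpace.exp (t • v)) {g : SL2} (hg : g ∈ H) (t : ℝ) :
    ∃ h ∈ H, (h : M2) = NormedSpace.exp (t • adjointConj g v) := by
  obtain ⟨h, hH, he⟩ := hv t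
  refine ⟨g * h * g⁻¹, mul_mem (mul_mem hg hH) (inv_mem hg), ?_⟩
  have hinv : (g : M2)⁻¹ = ((g⁻¹ : SL2) : M2) := Matrix.inv_eq_right_inv (coe_mul_coe_inv g)
  have hun : IsUnit (g : M2) := (Matrix.isUnit_iff_isUnit_det _).2 (by simp)
  have : t • adjointConj g v = (g : M2) * (t • v) * (g : M2)⁻¹ := by
    rw [hinv, adjointConj, Matrix.mul_smul, Matrix.smul_mul]
  rw [this, Matrix.exp_conj _ _ hun, ← he, hinv, Matrix.SpecialLinearGroup.coe_mul,
    Matrix.SpecialLinearGroup.coe_mul]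

/-- A closed nondiscrete subgroup of `SL₂(ℝ)` normalizing no line of traceless matrices
is open. -/
theorem mem_nhds_one_of_forall_not_commute {H : Subgroup SL2} (hc : IsClosed (H : Set SL2))
    (hnd : ∀ U ∈ 𝓝 (1 : SL2), ∃ h ∈ H, h ∈ U ∧ h ≠ 1)
    (hno : ∀ u : M2, u ≠ 0 → u.trace = 0 → ∃ h ∈ H, ¬ Commute (adjointConj h u) u) :
    (H : Set SL2) ∈ 𝓝 1 := by
  obtain ⟨v, hv0, hv⟩ := exists_exp_smul_mem hc hnd
  have hvt : v.trace = 0 := trace_eq_zero_of_det_exp_smul fun t => by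
    obtain ⟨h, _, he⟩ := hv t
    rw [← he, Matrix.SpecialLinearGroup.det_coe]
  obtain ⟨h₁, hh₁, hnc⟩ := hno v hv0 hvt
  have hwt : (adjointConj h₁ v).trace = 0 := (trace_adjointConj _ _).trans hvt
  set u := v * adjointConj h₁ v - adjointConj h₁ v * v with hu
  have hu0 : u ≠ 0 := fun h => hnc (sub_eq_zero.1 h).symm
  have hut : u.trace = 0 := by rw [hu, Matrix.trace_sub, Matrix.trace_mul_comm, sub_self]
  obtain ⟨h, hh, hnc'⟩ := hno u hu0 hut
  -- If all conjugates of `v` under `H` were trace-orthogonal to `u`, then `adjointConj h u` would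
  -- be orthogonal to both `v` and `adjointConj h₁ v`, and so commute with their commutator `u`.
  have hex : ∃ h₂ ∈ H, (u * adjointConj h₂ v).trace ≠ 0 := by
    by_contra! hcon
    refine hnc' (commute_of_trace_mul_eq_zero ((trace_adjointConj _ _).trans hut) hvt hwt ?_ ?_)
    · rw [trace_adjointConj_mul]; exact hcon _ (inv_mem hh)
    · rw [trace_adjointConj_mul, ← adjointConj_mul]; exact hcon _ (mul_mem (inv_mem hh) hh₁)
  obtain ⟨h₂, hh₂, hT⟩ := hex
  exact mem_nhds_one_of_exp_smul_mem hv (exp_smul_adjointConj_mem hv hh₁)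
    (exp_smul_adjointConj_mem hv hh₂) (exists_smul_add_eq_of_trace_ne_zero hvt hwt
      ((trace_adjointConj _ _).trans hvt) hT)

end Density

/-! ### Descent to `PSL₂(ℝ)` and conclusion -/

section PSL

local notation "SL2" => Matrix.SpecialLinearGroup (Fin 2) ℝ

instance : LocallyCompactSpace SL2 :=
  have : LocallyCompactSpace (Matrix (Fin 2) (Fin 2) ℝ) :=
    inferInstanceAs (LocallyCompactSpace (Fin 2 → Fin 2 → ℝ))
  Matrix.SpecialLinearGroup.isClosedEmbedding_val.locallyCompactSpace

instance : SecondCountableTopology SL2 :=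
  have : SecondCountableTopology (Matrix (Fin 2) (Fin 2) ℝ) :=
    inferInstanceAs (SecondCountableTopology (Fin 2 → Fin 2 → ℝ))
  Matrix.SpecialLinearGroup.isClosedEmbedding_val.isEmbedding.secondCountableTopology


/-- A transitive action of `PSL₂(ℝ)` with open orbit maps and a finite invariant measure of full
support has discrete or open stabilizers. -/
theorem discreteTopology_or_isOpen_stabilizer {X : Type*} [TopologicalSpace X] [T1Space X]
    [MulAction PSL2R X] [ContinuousSMul PSL2R X] [MeasurableSpace X] [BorelSpace X]
    (μ : Measure X) [IsFiniteMeasure μ] [SMulInvariantMeasure PSL2R X μ] [μ.IsOpenPosMeasure]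
    (x₀ : X) (ho : IsOpenMap fun g : PSL2R => g • x₀) :
    DiscreteTopology (MulAction.stabilizer PSL2R x₀) ∨
      IsOpen (MulAction.stabilizer PSL2R x₀ : Set PSL2R) := by
  let q : SL2 →* PSL2R := QuotientGroup.mk' _
  have hq : IsOpenMap q := QuotientGroup.isOpenMap_coe
  have hqc : Continuous q := QuotientGroup.continuous_mk
  let : MulAction SL2 X := MulAction.compHom X q
  have hsmul : ∀ (g : SL2) (x : X), g • x = q g • x := fun _ _ => rfl
  have : ContinuousConstSMul SL2 X := ⟨fun g => continuous_const_smul (q g)⟩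
  have : SMulInvariantMeasure SL2 X μ := ⟨fun g s hs => measure_preimage_smul μ (q g) s⟩
  have hoq : IsOpenMap fun g : SL2 => g • x₀ := ho.comp hq
  have hstab : ∀ g : SL2, g ∈ MulAction.stabilizer SL2 x₀ ↔
      q g ∈ MulAction.stabilizer PSL2R x₀ := fun g => Iff.rfl
  have hcl : IsClosed (MulAction.stabilizer SL2 x₀ : Set SL2) := by
    have hc : Continuous fun g : SL2 => g • x₀ :=
      (show Continuous fun g : PSL2R => g • x₀ by fun_prop).comp hqc
    exact isClosed_singleton.preimage hc
  by_cases hnd : ∀ U ∈ 𝓝 (1 : SL2), ∃ h ∈ MulAction.stabilizer SL2 x₀, h ∈ U ∧ h ≠ 1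
  · right
    have hn := mem_nhds_one_of_forall_not_commute hcl hnd fun u hu ht =>
      exists_not_commute_adjointConj μ x₀ hoq hu ht
    refine Subgroup.isOpen_of_mem_nhds _ (g := 1) (mem_of_superset (hq.image_mem_nhds hn) ?_)
    rintro _ ⟨g, hg, rfl⟩
    exact (hstab g).1 hg
  · left
    push Not at hnd
    obtain ⟨U, hU, hU1⟩ := hnd
    refine discreteTopology_of_isOpen_singleton_one ?_
    -- A stabilizer element in the image of `interior U` has a lift in `U`, which stabilizes `x₀`
    -- and is therefore `1`.
    convert (hq _ (isOpen_interior (s := U))).preimage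
      (continuous_subtype_val (p := (· ∈ MulAction.stabilizer PSL2R x₀))) using 1
    ext h
    constructor
    · rintro rfl
      exact ⟨1, mem_interior_iff_mem_nhds.2 hU, map_one q⟩
    · rintro ⟨g, hg, hgh⟩
      have hgs : g ∈ MulAction.stabilizer SL2 x₀ := (hstab g).2 (hgh ▸ h.2)
      refine Subtype.ext ?_
      rw [← hgh, hU1 g hgs (interior_subset hg)]
      exact map_one q

end PSL

theorem theorem9p4
    [MeasurableSpace PSL2R] [BorelSpace PSL2R]
    (haar : Measure PSL2R) [haar.IsHaarMeasure]
    (X : Type*) [TopologicalSpace X] [ConnectedSpace X] [T2Space X]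
    [MulAction PSL2R X] [ContinuousSMul PSL2R X]
    [MeasurableSpace X] [BorelSpace X]
    (μ : Measure X) [IsProbabilityMeasure μ] [SMulInvariantMeasure PSL2R X μ]
    [μ.IsOpenPosMeasure]
    (hSob : QualitativeSobolevEmbedding haar μ) :
    (∃ x : X, ∀ y : X, y = x) ∨
      ∃ Γ : Subgroup PSL2R, IsCocompactLattice Γ ∧ GSpaceIsomorphic PSL2R X (CosetSpace Γ) := by
  obtain ⟨W, h1, hW, δ, hδ0, hδ⟩ := hSob.exists_pos_le_measure_smul haar μ
  obtain ⟨s, K, hK, hs⟩ := exists_finset_forall_mem_smul μ hW hδ0 hδ ⟨1, h1⟩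
  have := compactSpace_of_forall_mem_smul s hK hs
  have := isPretransitive_of_forall_mem_smul s hK hs
  obtain ⟨x₀⟩ := ‹ConnectedSpace X›.toNonempty
  -- Baire category applies: the group is σ-compact and `X` is compact Hausdorff.
  have ho : IsOpenMap fun g : PSL2R => g • x₀ := isOpenMap_smul_of_sigmaCompact x₀
  rcases discreteTopology_or_isOpen_stabilizer μ x₀ ho with hd | hopen
  · exact Or.inr (exists_isCocompactLattice_of_discrete_stabilizer μ x₀ ho hd)
  · exact Or.inl ⟨x₀, eq_of_isOpen_stabilizer x₀ ho hopen⟩
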